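/- For every $n\ge 0$ let $c_1,\dots,c_n$ be Fermi operators on a complex Hilbert space of dimension $2^n$, i.e. $\{c_i,c_j\}=0$ and $\{c_i,c_j^\dagger\}=\delta_{ij}$. Let $(\Omega,\mathcal F,\mathbb P)$ be a probability space with expectation $\mathbb E$, and for every $n$ let $A(\omega)=(A_{ij}(\omega))_{i,j\ge1}$, $B(\omega)=(B_{ij}(\omega))_{i,j\ge1}$ be random double arrays of real numbers (which may also depend on $n$) with $A_{ij}(\omega)=A_{ji}(\omega)$ and $B_{ij}(\omega)=-B_{ji}(\omega)$. Consider the random quadratic form $$\mathcal H_n(\omega)=\sum_{i,j=1}^n\Big(A_{ij}(\omega)\,c_i^\dagger c_j+\tfrac12 B_{ij}(\omega)\,(c_ic_j-c_i^\dagger c_j^\dagger)\Big),$$ a self-adjoint operator with eigenvalues $E_{1,n}(\omega),\dots,E_{2^n,n}(\omega)$ (listed with multiplicity). Put $K_n(\omega)=\tfrac12\sum_{i=1}^nA_{ii}(\omega)$, let $X_n(\omega)$ be the $n\times n$ matrix with entries $A_{ij}(\omega)+B_{ij}(\omega)$, $1\le i,j\le n$, and let $\|\cdot\|_{\mathrm{op}}$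 be the operator norm (largest singular value). Suppose that for a deterministic $\sigma\in\mathbb R$ the following hold $\mathbb P$-almost surely: (i) $\displaystyle\lim_{n\to\infty}n^{-1/4}\|X_n(\omega)\|_{\mathrm{op}}=0$; (ii) $\displaystyle\lim_{n\to\infty}\frac1{4n}\mathrm{Tr}\big(X_n(\omega)^TX_n(\omega)\big)=\sigma^2$. Then the densities of rescaled energy levels $$\nu_n(\cdot\,;\omega)=\frac1{2^n}\sum_{k=1}^{2^n}\delta_{(E_{k,n}(\omega)-K_n(\omega))/\sqrt n}$$ converge weakly in average to the centred Gaussian probability measure $\gamma_{\sigma^2}$ with variance $\sigma^2$ (the Dirac mass at $0$ if $\sigma=0$): for every bounded continuous $f:\mathbb R\to\mathbb R$ the random variable $\omega\mapsto\int f\,d\nu_n(\cdot\,;\omega)$ is integrable for every $n$, and $$\mathbb E\int f\,d\nu_n(\cdot\,;\omega)\;\longrightarrow\;\int f\,d\gamma_{\sigma^2}\qquad(n\to\infty).$$ -/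

import Mathlib

open MeasureTheory ProbabilityTheory Filter Topology
open scoped ENNReal BoundedContinuousFunction

/-- A family of `n` Fermi operators on a finite-dimensional complex Hilbert space: the canonical
anticommutation relations `{c_i, c_j} = 0` and `{c_i, c_j†} = δ_{ij}`. -/
structure IsFermiFamily {n : ℕ} {V : Type*} [NormedAddCommGroup V] [InnerProductSpace ℂ V]
    [FiniteDimensional ℂ V] (c : Fin n → V →ₗ[ℂ] V) : Prop where
  anticomm : ∀ i j, c i * c j + c j * c i = 0
  anticomm_adjoint : ∀ i j,
    c i * LinearMap.adjoint (c j) + LinearMap.adjoint (c j) * c i = if i = j then 1 else 0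

section Fock

/-- The sign attached to site `i` in the occupation state `S`: the parity of the number of
occupied sites before `i`. -/
def fockSign {n : ℕ} (i : Fin n) (S : Finset (Fin n)) : ℂ :=
  (-1) ^ (S.filter (fun j => j < i)).card

/-- The annihilation operator of site `i` on the fermionic Fock space over `n` sites, realised on
functions of the set of occupied sites. -/
noncomputable def fockAnnihilation {n : ℕ} (i : Fin n) :
    EuclideanSpace ℂ (Finset (Fin n)) →ₗ[ℂ] EuclideanSpace ℂ (Finset (Fin n)) where
  toFun ψ := WithLp.toLp 2 fun S => if i ∈ S then 0 else fockSign i S * ψ (insert i S)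
  map_add' ψ φ := by
    ext S
    by_cases h : i ∈ S <;> simp [h, mul_add]
  map_smul' a ψ := by
    ext S
    by_cases h : i ∈ S <;> simp [h, mul_left_comm]

/-- The creation operator of site `i` on the fermionic Fock space over `n` sites. -/
noncomputable def fockCreation {n : ℕ} (i : Fin n) :
    EuclideanSpace ℂ (Finset (Fin n)) →ₗ[ℂ] EuclideanSpace ℂ (Finset (Fin n)) where
  toFun ψ := WithLp.toLp 2 fun S => if i ∈ S then fockSign i S * ψ (S.erase i) else 0
  map_add' ψ φ := by
    ext S
    by_cases h : i ∈ S <;> simp [h, mul_add]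
  map_smul' a ψ := by
    ext S
    by_cases h : i ∈ S <;> simp [h, mul_left_comm]

theorem fockSign_insert {n : ℕ} {i j : Fin n} {S : Finset (Fin n)} (hj : j ∉ S) :
    fockSign i (insert j S) = (if j < i then -1 else 1) * fockSign i S := by
  unfold fockSign
  rw [Finset.filter_insert]
  split_ifs with h
  · rw [Finset.card_insert_of_notMem (by simp [hj]), pow_succ]
    ring
  · simp

theorem fockSign_erase {n : ℕ} {i j : Fin n} {S : Finset (Fin n)} (hj : j ∈ S) :
    fockSign i (S.erase j) = (if j < i then -1 else 1) * fockSign i S := by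
  have h := fockSign_insert (i := i) (Finset.notMem_erase j S)
  rw [Finset.insert_erase hj] at h
  rw [h]
  split_ifs <;> ring

theorem fockSign_mul_self {n : ℕ} (i : Fin n) (S : Finset (Fin n)) :
    fockSign i S * fockSign i S = 1 := by
  unfold fockSign
  rw [← mul_pow]
  simp

theorem star_fockSign {n : ℕ} (i : Fin n) (S : Finset (Fin n)) :
    (starRingEnd ℂ) (fockSign i S) = fockSign i S := by
  simp [fockSign]

theorem adjoint_fockAnnihilation {n : ℕ} (i : Fin n) :
    LinearMap.adjoint (fockAnnihilation i) = fockCreation i := by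
  symm
  rw [LinearMap.eq_adjoint_iff]
  intro ψ φ
  simp only [PiLp.inner_apply, RCLike.inner_apply, fockAnnihilation, fockCreation,
    LinearMap.coe_mk, AddHom.coe_mk]
  rw [← Finset.sum_filter_add_sum_filter_not Finset.univ (fun S : Finset (Fin n) => i ∈ S),
    ← Finset.sum_filter_add_sum_filter_not Finset.univ (fun S : Finset (Fin n) => i ∈ S)
      (fun S => _ * (starRingEnd ℂ) (ψ S))]
  rw [Finset.sum_eq_zero (s := Finset.univ.filter (fun S : Finset (Fin n) => ¬ i ∈ S)),
    Finset.sum_eq_zero (s := Finset.univ.filter (fun S : Finset (Fin n) => i ∈ S))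
      (f := fun S => _ * (starRingEnd ℂ) (ψ S)), add_zero, zero_add]
  · refine Finset.sum_nbij' (fun S => S.erase i) (fun S => insert i S) ?_ ?_ ?_ ?_ ?_
    · intro S _; simp
    · intro S _; simp
    · intro S hS; exact Finset.insert_erase (by simpa using hS)
    · intro S hS; exact Finset.erase_insert (by simpa using hS)
    · intro S hS
      have hS' : i ∈ S := by simpa using hS
      simp [hS', fockSign_erase hS', Finset.insert_erase hS', star_fockSign]
      ring
  · intro S hS
    have hS' : i ∈ S := by simpa using hS
    simp [hS']
  · intro S hS
    have hS' : i ∉ S := by simpa using hS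
    simp [hS']

/-- The Fock space over `n` sites, of dimension `2 ^ n`, carries a family of Fermi operators. -/
theorem isFermiFamily_fockAnnihilation (n : ℕ) :
    IsFermiFamily (fun i : Fin n => fockAnnihilation i) ∧
      Module.finrank ℂ (EuclideanSpace ℂ (Finset (Fin n))) = 2 ^ n := by
  refine ⟨⟨?_, ?_⟩, by simp⟩
  · intro i j
    refine LinearMap.ext fun ψ => ?_
    ext S
    simp only [LinearMap.add_apply, Module.End.mul_apply, fockAnnihilation, LinearMap.coe_mk,
      AddHom.coe_mk, PiLp.add_apply, LinearMap.zero_apply, PiLp.zero_apply, Finset.mem_insert]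
    rcases eq_or_ne i j with rfl | hij
    · simp
    by_cases hi : i ∈ S
    · simp [hi]
    by_cases hj : j ∈ S
    · simp [hj]
    simp only [hi, hj, hij, hij.symm, if_false, or_self, fockSign_insert hi, fockSign_insert hj,
      Finset.insert_comm i j]
    rcases lt_or_gt_of_ne hij with h | h <;> simp only [h, h.not_gt, if_true, if_false] <;> ring
  · intro i j
    simp only [adjoint_fockAnnihilation]
    refine LinearMap.ext fun ψ => ?_
    ext S
    simp only [LinearMap.add_apply, Module.End.mul_apply, fockAnnihilation, fockCreation,
      LinearMap.coe_mk, AddHom.coe_mk, PiLp.add_apply, Finset.mem_insert, Finset.mem_erase]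
    rcases eq_or_ne i j with rfl | hij
    · by_cases hi : i ∈ S
      · simp [hi, fockSign_erase hi, ← mul_assoc, fockSign_mul_self]
      · simp [hi, fockSign_insert hi, ← mul_assoc, fockSign_mul_self]
    by_cases hi : i ∈ S
    · simp [hi, hij]
    by_cases hj : j ∈ S
    · simp only [hi, hj, hij, hij.symm, if_false, if_true, or_true, and_false, fockSign_insert hi,
        fockSign_erase hj, Finset.erase_insert_of_ne hij, LinearMap.zero_apply, PiLp.zero_apply]
      rcases lt_or_gt_of_ne hij with h | h <;> simp only [h, h.not_gt, if_true, if_false] <;> ring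
    · simp [hi, hj, hij, hij.symm]

end Fock

/-- The quadratic form in Fermi operators
`H_n = ∑_{i,j} A_{ij} c_i† c_j + (1/2) B_{ij} (c_i c_j - c_i† c_j†)`. -/
noncomputable def quadraticHamiltonian {n : ℕ} {V : Type*} [NormedAddCommGroup V]
    [InnerProductSpace ℂ V] [FiniteDimensional ℂ V] (c : Fin n → V →ₗ[ℂ] V)
    (A B : ℕ → ℕ → ℝ) : V →ₗ[ℂ] V :=
  ∑ i : Fin n, ∑ j : Fin n,
    ((A i j : ℂ) • (LinearMap.adjoint (c i) * c j) +
      ((1 / 2 : ℂ) * (B i j : ℂ)) •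
        (c i * c j - LinearMap.adjoint (c i) * LinearMap.adjoint (c j)))

theorem quadraticHamiltonian_isSymmetric {n : ℕ} {V : Type*} [NormedAddCommGroup V]
    [InnerProductSpace ℂ V] [FiniteDimensional ℂ V] (c : Fin n → V →ₗ[ℂ] V)
    (A B : ℕ → ℕ → ℝ) (hA : ∀ i j, A i j = A j i) (hB : ∀ i j, B i j = -B j i) :
    (quadraticHamiltonian c A B).IsSymmetric := by
  have hs : ∀ T : V →ₗ[ℂ] V, LinearMap.adjoint T = star T := fun _ => rfl
  rw [LinearMap.isSymmetric_iff_isSelfAdjoint, isSelfAdjoint_iff]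
  unfold quadraticHamiltonian
  simp only [hs, star_sum, star_add, star_smul, star_mul, star_sub, star_star]
  rw [Finset.sum_comm]
  refine Finset.sum_congr rfl fun i _ => Finset.sum_congr rfl fun j _ => ?_
  rw [hA j i, hB j i]
  simp
  module

/-- The energy levels `E_{k,n}`: the `2 ^ n` eigenvalues of `H_n`, listed with multiplicity. -/
noncomputable def energyLevel {n : ℕ} {V : Type*} [NormedAddCommGroup V]
    [InnerProductSpace ℂ V] [FiniteDimensional ℂ V] (hV : Module.finrank ℂ V = 2 ^ n)
    (c : Fin n → V →ₗ[ℂ] V) (A B : ℕ → ℕ → ℝ)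
    (hA : ∀ i j, A i j = A j i) (hB : ∀ i j, B i j = -B j i) : Fin (2 ^ n) → ℝ :=
  (quadraticHamiltonian_isSymmetric c A B hA hB).eigenvalues hV

/-- The shift `K_n = Tr (P_n A P_n) / 2`. -/
noncomputable def energyShift (n : ℕ) (A : ℕ → ℕ → ℝ) : ℝ :=
  (∑ i : Fin n, A i i) / 2

/-- The density of rescaled energy levels: the normalised counting measure
`ν_n = 2⁻ⁿ ∑_k δ_{(E_{k,n} - K_n) / √n}`. -/
noncomputable def rescaledLevelDensity {n : ℕ} {V : Type*} [NormedAddCommGroup V]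
    [InnerProductSpace ℂ V] [FiniteDimensional ℂ V] (hV : Module.finrank ℂ V = 2 ^ n)
    (c : Fin n → V →ₗ[ℂ] V) (A B : ℕ → ℕ → ℝ)
    (hA : ∀ i j, A i j = A j i) (hB : ∀ i j, B i j = -B j i) : Measure ℝ :=
  ((2 : ℝ≥0∞) ^ n)⁻¹ • ∑ k : Fin (2 ^ n),
    Measure.dirac ((energyLevel hV c A B hA hB k - energyShift n A) / Real.sqrt n)

/-- The matrix `X_n = P_n (A + B) P_n`, as an `n × n` matrix. -/
def truncatedSum (n : ℕ) (A B : ℕ → ℕ → ℝ) : Matrix (Fin n) (Fin n) ℝ :=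
  Matrix.of fun i j => A i j + B i j

/-- The operator norm of a square matrix with respect to the Euclidean norm
(its largest singular value). -/
noncomputable def matrixOpNorm {n : ℕ} (X : Matrix (Fin n) (Fin n) ℝ) : ℝ :=
  ‖Matrix.toEuclideanCLM (𝕜 := ℝ) X‖

/-!
The Majorana operators `c i + (c i)†` and `c i - (c i)†` anticommute with each other and square to
`1` and `-1`. In them the Hamiltonian, centred by the shift `K`, is the bilinear form
`1 / 2 * ∑ X i j (c i + (c i)†) (c j - (c j)†)` of the matrix `X = A + B`. The anticommutation
relations are invariant under independent rotations of the two families, so the singular value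
decomposition of `X` (`exists_matrix_singular_decomposition`) brings the centred Hamiltonian to the
form `∑ s k / 2 • q k`, with commuting involutions `q k`. Every `q k` anticommutes with an
involution that commutes with the other `q l`, so every combination of signs has the same
multiplicity in the joint spectrum (`trace_aeval_sum_smul`), and the `2 ^ n` centred energy levels
are exactly the sums `∑ ± s k / 2` (`IsFermiFamily.sum_energyLevel`).

Hence the rescaled level density is the law of a sum of independent signs with weights
`s k / (2 √n)`, and its characteristic function is `∏ cos (t s k / (2 √n))`. As
`∑ (s k) ^ 2 = Tr (Xᵀ X)` and `s k ≤ ‖X‖`, the two hypotheses are Lyapunov's condition for the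
central limit theorem (`tendsto_prod_cos`), and Lévy's continuity theorem gives weak convergence for
almost every realisation. Dominated convergence takes this to expectations. The measurability needed
there does not follow from that of single eigenvalues or singular vectors; it comes from the power
sums of the levels, which are traces and thus polynomials in the coefficients, through polynomial
approximation (`measurable_sum_of_forall_polynomial`).
-/

/-! ### Traces of polynomials in commuting involutions -/

section Trace

open Polynomial

variable {V : Type*} [AddCommGroup V] [Module ℂ V]

/-- If `y` and `z` agree after multiplication by `e` on the right, so do all polynomials in them. -/
theorem aeval_mul_eq_of_mul_eq {R : Type*} [Ring R] [Algebra ℂ R] {y z e : R}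
    (h : y * e = z * e) (hze : Commute z e) (p : ℂ[X]) : aeval y p * e = aeval z p * e := by
  have hpow : ∀ m : ℕ, y ^ m * e = z ^ m * e := by
    intro m
    induction m with
    | zero => simp
    | succ m ih =>
      rw [pow_succ, mul_assoc, h, hze.eq, ← mul_assoc, ih, mul_assoc, ← hze.eq, ← mul_assoc,
        ← pow_succ]
  induction p using Polynomial.induction_on' with
  | add p q hp hq => simp [add_mul, hp, hq]
  | monomial m r => simp [aeval_monomial, mul_assoc, hpow m]

/-- An operator which anticommutes with an involution `a` is traceless, also after multiplication
by an operator which commutes with `a`. -/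
theorem trace_mul_eq_zero_of_anticommute {a q y : Module.End ℂ V}
    (ha : a * a = 1) (haq : a * q = -(q * a)) (hay : Commute a y) :
    LinearMap.trace ℂ V (y * q) = 0 := by
  have h1 : LinearMap.trace ℂ V (y * q) = -LinearMap.trace ℂ V (y * q) := by
    calc LinearMap.trace ℂ V (y * q)
        = LinearMap.trace ℂ V (a * (a * (y * q))) := by rw [← mul_assoc a a, ha, one_mul]
      _ = LinearMap.trace ℂ V (a * (y * q) * a) := by rw [LinearMap.trace_mul_comm]
      _ = LinearMap.trace ℂ V (-(y * q)) := by
        rw [← mul_assoc a y q, hay.eq, mul_assoc y a q, haq, mul_neg, neg_mul, mul_assoc y,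
          mul_assoc q, ha, mul_one]
      _ = -LinearMap.trace ℂ V (y * q) := by rw [map_neg]
  exact self_eq_neg.mp h1

/-- On the two eigenspaces of the involution `q` the operator `x + s q` acts as `x + s` and as
`x - s`; an involution `a` which commutes with `x` and exchanges these eigenspaces makes both
contribute equally to the trace. -/
theorem trace_aeval_add_smul {x q a : Module.End ℂ V} (s : ℂ) (hq : q * q = 1)
    (ha : a * a = 1) (haq : a * q = -(q * a)) (hax : Commute a x) (hxq : Commute x q)
    (p : ℂ[X]) :
    LinearMap.trace ℂ V (aeval (x + s • q) p) =
      1 / 2 * (LinearMap.trace ℂ V (aeval x (p.comp (X + C s))) +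
        LinearMap.trace ℂ V (aeval x (p.comp (X - C s)))) := by
  have e1 : aeval x (X + C s) = x + s • (1 : Module.End ℂ V) := by
    simp [Algebra.algebraMap_eq_smul_one]
  have e2 : aeval x (X - C s) = x - s • (1 : Module.End ℂ V) := by
    simp [Algebra.algebraMap_eq_smul_one]
  have hp := aeval_mul_eq_of_mul_eq (y := x + s • q) (z := x + s • 1) (e := 1 + q)
    (by simp only [mul_add, add_mul, smul_mul_assoc, hq, mul_one, one_mul]; abel)
    (by
      apply Commute.add_left
      · exact (Commute.one_right x).add_right hxq
      · exact (Commute.one_left _).smul_left s) p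
  have hm := aeval_mul_eq_of_mul_eq (y := x + s • q) (z := x - s • 1) (e := 1 - q)
    (by simp only [mul_sub, sub_mul, add_mul, smul_mul_assoc, hq, mul_one, one_mul]; abel)
    (by
      apply Commute.sub_left
      · exact (Commute.one_right x).sub_right hxq
      · exact (Commute.one_left _).smul_left s) p
  rw [aeval_comp, aeval_comp, e1, e2]
  set y := aeval (x + s • q) p
  have hcomm : ∀ r : ℂ[X], Commute a (aeval x r) := fun r => by
    induction r using Polynomial.induction_on' with
    | add p q hp hq => simpa using hp.add_right hq
    | monomial m r =>
      rw [aeval_monomial]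
      exact (Algebra.commute_algebraMap_right r a).mul_right (hax.pow_right m)
  have t1 : LinearMap.trace ℂ V (aeval (x + s • (1 : Module.End ℂ V)) p * q) = 0 := by
    rw [← e1, ← aeval_comp]
    exact trace_mul_eq_zero_of_anticommute ha haq (hcomm _)
  have t2 : LinearMap.trace ℂ V (aeval (x - s • (1 : Module.End ℂ V)) p * q) = 0 := by
    rw [← e2, ← aeval_comp]
    exact trace_mul_eq_zero_of_anticommute ha haq (hcomm _)
  have h1 := congrArg (LinearMap.trace ℂ V) hp
  have h2 := congrArg (LinearMap.trace ℂ V) hm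
  simp only [mul_add, mul_sub, mul_one, map_add, map_sub, t1, t2] at h1 h2
  linear_combination (1 / 2) * h1 + (1 / 2) * h2

/-- The spectrum of `∑ s k • q k`, for commuting involutions `q k` each of which is reversed by an
involution `a k` commuting with the others: every choice of signs in `∑ ± s k` occurs, and all of
them with the same multiplicity. -/
theorem trace_aeval_sum_smul {ι : Type*} [DecidableEq ι] {q a : ι → Module.End ℂ V}
    (hq : ∀ k, q k * q k = 1) (ha : ∀ k, a k * a k = 1) (haq : ∀ k, a k * q k = -(q k * a k))
    (hak : ∀ k l, k ≠ l → Commute (a k) (q l)) (hqq : ∀ k l, k ≠ l → Commute (q k) (q l))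
    (s : ι → ℂ) (T : Finset ι) (p : ℂ[X]) :
    LinearMap.trace ℂ V (aeval (∑ k ∈ T, s k • q k) p) =
      LinearMap.trace ℂ V 1 / 2 ^ T.card *
        ∑ S ∈ T.powerset, p.eval (∑ k ∈ S, s k - ∑ k ∈ T \ S, s k) := by
  induction T using Finset.induction_on generalizing p with
  | empty =>
    simp [aeval_def, eval₂_at_zero, Algebra.algebraMap_eq_smul_one,
      ← coeff_zero_eq_eval_zero, mul_comm]
  | insert k T hk ih =>
    rw [Finset.sum_insert hk, add_comm, trace_aeval_add_smul (s k) (hq k) (ha k) (haq k)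
      (Commute.sum_right _ _ _ fun l hl => (hak k l (by rintro rfl; exact hk hl)).smul_right _)
      (Commute.sum_left _ _ _ fun l hl => (hqq l k (by rintro rfl; exact hk hl)).smul_left _),
      ih, ih, Finset.sum_powerset_insert hk, Finset.card_insert_of_notMem hk]
    have h1 : ∀ S ∈ T.powerset, (p.comp (X - C (s k))).eval (∑ k ∈ S, s k - ∑ k ∈ T \ S, s k) =
        p.eval (∑ k ∈ S, s k - ∑ k ∈ insert k T \ S, s k) := by
      intro S hS
      have hkS : k ∉ S := fun h => hk (Finset.mem_powerset.mp hS h)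
      rw [Finset.insert_sdiff_of_notMem _ hkS, Finset.sum_insert (by simp [hk]), eval_comp]
      simp only [eval_sub, eval_X, eval_C]
      congr 1; ring
    have h2 : ∀ S ∈ T.powerset, (p.comp (X + C (s k))).eval (∑ k ∈ S, s k - ∑ k ∈ T \ S, s k) =
        p.eval (∑ k ∈ insert k S, s k - ∑ k ∈ insert k T \ insert k S, s k) := by
      intro S hS
      have hkS : k ∉ S := fun h => hk (Finset.mem_powerset.mp hS h)
      have : insert k T \ insert k S = T \ S := by grind
      rw [this, Finset.sum_insert hkS, eval_comp]
      simp only [eval_add, eval_X, eval_C]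
      congr 1; ring
    rw [Finset.sum_congr rfl h1, Finset.sum_congr rfl h2, pow_succ]
    field_simp
    ring

end Trace

/-- The trace of a polynomial in a symmetric operator is the sum of its values at the
eigenvalues. -/
theorem LinearMap.IsSymmetric.trace_aeval_eq_sum {V : Type*} [NormedAddCommGroup V]
    [InnerProductSpace ℂ V] [FiniteDimensional ℂ V] {N : ℕ} {M : V →ₗ[ℂ] V} (hM : M.IsSymmetric)
    (hN : Module.finrank ℂ V = N) (p : Polynomial ℂ) :
    LinearMap.trace ℂ V (Polynomial.aeval (R := ℂ) (A := Module.End ℂ V) M p) =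
      ∑ k, p.eval (hM.eigenvalues hN k : ℂ) := by
  rw [LinearMap.trace_eq_sum_inner _ (hM.eigenvectorBasis hN)]
  refine Finset.sum_congr rfl fun k _ => ?_
  rw [Module.End.aeval_apply_of_hasEigenvector (hM.hasEigenvector_eigenvectorBasis hN k),
    inner_smul_right]
  simp

/-- Finite families with the same sums of every polynomial have the same sums of every function, by
Lagrange interpolation. -/
theorem sum_eq_of_forall_polynomial {ι κ : Type*} [Fintype ι] [Fintype κ] {x : ι → ℂ} {y : κ → ℂ}
    (h : ∀ p : Polynomial ℂ, ∑ i, p.eval (x i) = ∑ j, p.eval (y j)) (g : ℂ → ℂ) :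
    ∑ i, g (x i) = ∑ j, g (y j) := by
  classical
  have key : ∀ z ∈ Finset.univ.image x ∪ Finset.univ.image y,
      (Lagrange.interpolate (Finset.univ.image x ∪ Finset.univ.image y) id g).eval z = g z :=
    fun z hz => Lagrange.eval_interpolate_at_node (v := id) g (Set.injOn_id _) hz
  have := h (Lagrange.interpolate (Finset.univ.image x ∪ Finset.univ.image y) id g)
  rw [Finset.sum_congr rfl fun i _ => key (x i) (by simp),
    Finset.sum_congr rfl fun j _ => key (y j) (by simp)] at this
  exact this

/-! ### Singular value decomposition of a real square matrix -/

section SVD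

open scoped InnerProductSpace

/-- Singular value decomposition: an endomorphism of a Euclidean space maps some orthonormal basis
to multiples of another one. -/
theorem exists_singular_bases {E : Type*} [NormedAddCommGroup E] [InnerProductSpace ℝ E]
    [FiniteDimensional ℝ E] {n : ℕ} (hn : Module.finrank ℝ E = n) (T : E →ₗ[ℝ] E) :
    ∃ (s : Fin n → ℝ) (u v : OrthonormalBasis (Fin n) ℝ E), ∀ k, T (v k) = s k • u k := by
  have hS : (LinearMap.adjoint T ∘ₗ T).IsSymmetric := T.isSymmetric_adjoint_mul_self
  set v := hS.eigenvectorBasis hn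
  have hTT : ∀ k l, ⟪T (v k), T (v l)⟫_ℝ = hS.eigenvalues hn l * if k = l then 1 else 0 := by
    intro k l
    rw [← LinearMap.adjoint_inner_right, ← LinearMap.comp_apply, hS.apply_eigenvectorBasis hn l,
      inner_smul_right]
    simp only [RCLike.ofReal_real_eq_id, id_eq]
    rw [orthonormal_iff_ite.mp v.orthonormal k l]
  set w : Fin n → E := fun k => (‖T (v k)‖)⁻¹ • T (v k)
  have hw : Orthonormal ℝ (Set.domRestrict {k | T (v k) ≠ 0} w) := by
    constructor
    · rintro ⟨k, hk⟩
      have hk' : ‖T (v k)‖ ≠ 0 := norm_ne_zero_iff.mpr hk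
      simp [w, norm_smul, hk']
    · rintro ⟨k, hk⟩ ⟨l, hl⟩ hkl
      have hkl' : k ≠ l := fun h => hkl (Subtype.ext h)
      simp [w, inner_smul_left, inner_smul_right, hTT, hkl']
  obtain ⟨u, hu⟩ := hw.exists_orthonormalBasis_extension_of_card_eq (by simpa using hn)
  refine ⟨fun k => ‖T (v k)‖, u, v, fun k => ?_⟩
  by_cases hk : T (v k) = 0
  · simp [hk]
  · rw [hu k hk, smul_inv_smul₀ (norm_ne_zero_iff.mpr hk)]

theorem sum_coord_mul_coord {n : ℕ}
    (u : OrthonormalBasis (Fin n) ℝ (EuclideanSpace ℝ (Fin n))) (k l : Fin n) :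
    ∑ i, u k i * u l i = if k = l then 1 else 0 := by
  rw [← orthonormal_iff_ite.mp u.orthonormal k l]
  simp [PiLp.inner_apply, mul_comm]

/-- The singular value decomposition in coordinates, with the bound of the singular values by the
operator norm and the Frobenius norm as the sum of their squares. -/
theorem exists_matrix_singular_decomposition {n : ℕ} (X : Matrix (Fin n) (Fin n) ℝ) :
    ∃ (s : Fin n → ℝ) (u v : OrthonormalBasis (Fin n) ℝ (EuclideanSpace ℝ (Fin n))),
      (∀ i j, X i j = ∑ k, s k * (u k i * v k j)) ∧
      (∀ k, |s k| ≤ matrixOpNorm X) ∧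
      ∑ k, s k ^ 2 = (X.transpose * X).trace := by
  obtain ⟨s, u, v, h⟩ := exists_singular_bases (E := EuclideanSpace ℝ (Fin n)) (n := n) (by simp)
    (Matrix.toEuclideanCLM (𝕜 := ℝ) X : EuclideanSpace ℝ (Fin n) →ₗ[ℝ] EuclideanSpace ℝ (Fin n))
  simp only [ContinuousLinearMap.coe_coe] at h
  have hX : ∀ i j, X i j = ∑ k, s k * (u k i * v k j) := by
    intro i j
    have h1 : X i j = (Matrix.toEuclideanCLM (𝕜 := ℝ) X (EuclideanSpace.single j 1)) i := by
      simp [Matrix.ofLp_toEuclideanCLM]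
    rw [h1, ← v.sum_repr' (EuclideanSpace.single j (1 : ℝ)), map_sum]
    simp only [map_smul, h, EuclideanSpace.inner_single_right]
    simp
    exact Finset.sum_congr rfl fun k _ => by ring
  refine ⟨s, u, v, hX, fun k => ?_, ?_⟩
  · have := (Matrix.toEuclideanCLM (𝕜 := ℝ) X).le_opNorm (v k)
    rw [h, norm_smul] at this
    simpa [matrixOpNorm] using this
  · have hu := sum_coord_mul_coord u
    have hv := sum_coord_mul_coord v
    symm
    calc (X.transpose * X).trace
        = ∑ j, ∑ i, (∑ k, s k * (u k i * v k j)) * ∑ l, s l * (u l i * v l j) := by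
          simp only [Matrix.trace, Matrix.diag, Matrix.mul_apply, Matrix.transpose_apply, hX]
      _ = ∑ j, ∑ i, ∑ k, ∑ l, s k * s l * (u k i * u l i) * (v k j * v l j) := by
          simp only [Finset.sum_mul_sum]
          refine Finset.sum_congr rfl fun j _ => Finset.sum_congr rfl fun i _ =>
            Finset.sum_congr rfl fun k _ => Finset.sum_congr rfl fun l _ => by ring
      _ = ∑ k, ∑ l, ∑ j, ∑ i, s k * s l * (u k i * u l i) * (v k j * v l j) := by
          rw [Finset.sum_congr rfl fun j _ => Finset.sum_comm]
          rw [Finset.sum_comm]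
          refine Finset.sum_congr rfl fun k _ => ?_
          rw [Finset.sum_congr rfl fun j _ => Finset.sum_comm]
          rw [Finset.sum_comm]
      _ = ∑ k, ∑ l, s k * s l * (∑ i, u k i * u l i) * (∑ j, v k j * v l j) := by
          simp only [Finset.mul_sum, Finset.sum_mul]
      _ = ∑ k, s k ^ 2 := by simp [hu, hv, sq]

end SVD

/-! ### Majorana operators -/

section Majorana

variable {n : ℕ} {V : Type*} [NormedAddCommGroup V] [InnerProductSpace ℂ V]
  [FiniteDimensional ℂ V]

/-- The Majorana operator `∑ i, u i • (c i + (c i)†)` in the direction `u`. -/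
noncomputable def majoranaPlus (c : Fin n → V →ₗ[ℂ] V) (u : Fin n → ℝ) : Module.End ℂ V :=
  ∑ i, (u i : ℂ) • (c i + LinearMap.adjoint (c i))

/-- The Majorana operator `∑ i, u i • (c i - (c i)†)` in the direction `u`, without the factor
`-I` which would make it self-adjoint; it squares to `-1` for a unit vector `u`. -/
noncomputable def majoranaMinus (c : Fin n → V →ₗ[ℂ] V) (u : Fin n → ℝ) : Module.End ℂ V :=
  ∑ i, (u i : ℂ) • (c i - LinearMap.adjoint (c i))

/-- Anticommutation relations extend bilinearly from generators to real linear combinations. -/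
theorem sum_smul_anticommutator {R : Type*} [Ring R] [Algebra ℂ R] {x y : Fin n → R} {r : ℂ}
    (h : ∀ i j, x i * y j + y j * x i = if i = j then algebraMap ℂ R r else 0) (u w : Fin n → ℝ) :
    (∑ i, (u i : ℂ) • x i) * (∑ j, (w j : ℂ) • y j) +
      (∑ j, (w j : ℂ) • y j) * (∑ i, (u i : ℂ) • x i) =
    algebraMap ℂ R (r * ((∑ i, u i * w i : ℝ) : ℂ)) := by
  rw [Finset.sum_mul_sum, Finset.sum_mul_sum, Finset.sum_comm (s := Finset.univ (α := Fin n))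
    (f := fun j i => (w j : ℂ) • y j * (u i : ℂ) • x i), ← Finset.sum_add_distrib]
  have : ∀ i, ∑ j, (u i : ℂ) • x i * (w j : ℂ) • y j + ∑ j, (w j : ℂ) • y j * (u i : ℂ) • x i =
      algebraMap ℂ R (r * (u i * w i)) := by
    intro i
    rw [← Finset.sum_add_distrib]
    have : ∀ j, (u i : ℂ) • x i * (w j : ℂ) • y j + (w j : ℂ) • y j * (u i : ℂ) • x i =
        if i = j then algebraMap ℂ R (r * (u i * w j)) else 0 := by
      intro j
      rw [smul_mul_smul_comm, smul_mul_smul_comm, mul_comm (w j : ℂ), ← smul_add, h]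
      split_ifs with hij
      · rw [Algebra.smul_def, ← map_mul]; congr 1; ring
      · simp
    rw [Finset.sum_congr rfl fun j _ => this j]
    simp only [Finset.sum_ite_eq, Finset.mem_univ, if_true]
  rw [Finset.sum_congr rfl fun i _ => this i, ← map_sum]
  congr 1
  push_cast
  rw [Finset.mul_sum]

variable {c : Fin n → V →ₗ[ℂ] V}

theorem IsFermiFamily.adjoint_anticomm (hc : IsFermiFamily c) (i j : Fin n) :
    LinearMap.adjoint (c i) * LinearMap.adjoint (c j) +
      LinearMap.adjoint (c j) * LinearMap.adjoint (c i) = 0 := by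
  have hs : ∀ T : V →ₗ[ℂ] V, LinearMap.adjoint T = star T := fun _ => rfl
  have := congrArg star (hc.anticomm j i)
  simpa only [hs, star_add, star_mul, star_zero] using this

theorem IsFermiFamily.majoranaPlus_anticomm (hc : IsFermiFamily c) (u w : Fin n → ℝ) :
    majoranaPlus c u * majoranaPlus c w + majoranaPlus c w * majoranaPlus c u =
      algebraMap ℂ _ (2 * ((∑ i, u i * w i : ℝ) : ℂ)) := by
  refine sum_smul_anticommutator (fun i j => ?_) u w
  have h1 := hc.anticomm i j
  have h2 := hc.anticomm_adjoint i j
  have h3 := hc.anticomm_adjoint j i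
  have h4 := hc.adjoint_anticomm i j
  calc _ = (c i * c j + c j * c i) + (c i * LinearMap.adjoint (c j) + LinearMap.adjoint (c j) * c i)
        + (c j * LinearMap.adjoint (c i) + LinearMap.adjoint (c i) * c j)
        + (LinearMap.adjoint (c i) * LinearMap.adjoint (c j) +
          LinearMap.adjoint (c j) * LinearMap.adjoint (c i)) := by noncomm_ring
    _ = _ := by
      rw [h1, h2, h3, h4]
      simp only [eq_comm (a := j)]
      split_ifs
      · rw [map_ofNat]; norm_num
      · simp

theorem IsFermiFamily.majoranaMinus_anticomm (hc : IsFermiFamily c) (u w : Fin n → ℝ) :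
    majoranaMinus c u * majoranaMinus c w + majoranaMinus c w * majoranaMinus c u =
      algebraMap ℂ _ (-2 * ((∑ i, u i * w i : ℝ) : ℂ)) := by
  refine sum_smul_anticommutator (fun i j => ?_) u w
  have h1 := hc.anticomm i j
  have h2 := hc.anticomm_adjoint i j
  have h3 := hc.anticomm_adjoint j i
  have h4 := hc.adjoint_anticomm i j
  calc _ = (c i * c j + c j * c i) - (c i * LinearMap.adjoint (c j) + LinearMap.adjoint (c j) * c i)
        - (c j * LinearMap.adjoint (c i) + LinearMap.adjoint (c i) * c j)
        + (LinearMap.adjoint (c i) * LinearMap.adjoint (c j) +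
          LinearMap.adjoint (c j) * LinearMap.adjoint (c i)) := by noncomm_ring
    _ = _ := by
      rw [h1, h2, h3, h4]
      simp only [eq_comm (a := j)]
      split_ifs
      · rw [map_neg, map_ofNat]; norm_num
      · simp

theorem IsFermiFamily.majoranaPlus_majoranaMinus_anticomm (hc : IsFermiFamily c)
    (u w : Fin n → ℝ) :
    majoranaPlus c u * majoranaMinus c w + majoranaMinus c w * majoranaPlus c u = 0 := by
  have := sum_smul_anticommutator (r := 0) (x := fun i => c i + LinearMap.adjoint (c i))
    (y := fun i => c i - LinearMap.adjoint (c i)) (fun i j => ?_) u w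
  · rwa [zero_mul, map_zero] at this
  have h1 := hc.anticomm i j
  have h2 := hc.anticomm_adjoint i j
  have h3 := hc.anticomm_adjoint j i
  have h4 := hc.adjoint_anticomm i j
  calc _ = (c i * c j + c j * c i) - (c i * LinearMap.adjoint (c j) + LinearMap.adjoint (c j) * c i)
        + (c j * LinearMap.adjoint (c i) + LinearMap.adjoint (c i) * c j)
        - (LinearMap.adjoint (c i) * LinearMap.adjoint (c j) +
          LinearMap.adjoint (c j) * LinearMap.adjoint (c i)) := by noncomm_ring
    _ = _ := by
      rw [h1, h2, h3, h4]
      simp [eq_comm (a := j)]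

/-- In the Majorana operators the Hamiltonian, centred by the shift, is the bilinear form of the
matrix `A + B`: the symmetry of `A` and the antisymmetry of `B` remove the remaining terms. -/
theorem IsFermiFamily.quadraticHamiltonian_sub_shift (hc : IsFermiFamily c) (A B : ℕ → ℕ → ℝ)
    (hA : ∀ i j, A i j = A j i) (hB : ∀ i j, B i j = -B j i) :
    quadraticHamiltonian c A B - algebraMap ℂ (Module.End ℂ V) (energyShift n A : ℂ) =
      ∑ i, ∑ j, ((truncatedSum n A B i j : ℂ) / 2) •
        ((c i + LinearMap.adjoint (c i)) * (c j - LinearMap.adjoint (c j))) := by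
  have hsymm : ∀ F : Fin n → Fin n → Module.End ℂ V,
      ∑ i, ∑ j, F i j = (1 / 2 : ℂ) • ∑ i, ∑ j, (F i j + F j i) := by
    intro F
    simp only [Finset.sum_add_distrib]
    rw [Finset.sum_comm (f := fun i j => F j i)]
    module
  have hshift : algebraMap ℂ (Module.End ℂ V) (energyShift n A : ℂ) =
      ∑ i : Fin n, ∑ j : Fin n, ((A i j : ℂ) / 2) • (if i = j then (1 : Module.End ℂ V) else 0) := by
    simp [energyShift, Algebra.algebraMap_eq_smul_one, ← Finset.sum_smul, Finset.sum_div]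
  rw [hshift]
  unfold quadraticHamiltonian
  simp only [← Finset.sum_sub_distrib]
  rw [hsymm, hsymm (fun i j => ((truncatedSum n A B i j : ℂ) / 2) • _)]
  congr 1
  refine Finset.sum_congr rfl fun i _ => Finset.sum_congr rfl fun j _ => ?_
  have h1 := hc.anticomm i j
  have h2 := hc.anticomm_adjoint i j
  have h3 := hc.anticomm_adjoint j i
  have h4 := hc.adjoint_anticomm i j
  simp only [eq_comm (a := j) (b := i)] at h3 ⊢
  have hB' : (B j i : ℂ) = -B i j := by rw [hB j i]; push_cast; rfl
  simp only [truncatedSum, Matrix.of_apply, hA j i, Complex.ofReal_add, hB', mul_sub, add_mul]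
  rw [eq_neg_of_add_eq_zero_right h1, eq_neg_of_add_eq_zero_right h4,
    eq_sub_of_add_eq h2, eq_sub_of_add_eq h3]
  module

/-- Singular vectors of `A + B` turn the centred Hamiltonian into a combination of independent
commuting involutions with the halved singular values as coefficients. -/
theorem IsFermiFamily.quadraticHamiltonian_sub_shift_eq_sum (hc : IsFermiFamily c)
    (A B : ℕ → ℕ → ℝ) (hA : ∀ i j, A i j = A j i) (hB : ∀ i j, B i j = -B j i)
    {s : Fin n → ℝ} {u v : Fin n → Fin n → ℝ}
    (hX : ∀ i j, truncatedSum n A B i j = ∑ k, s k * (u k i * v k j)) :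
    quadraticHamiltonian c A B - algebraMap ℂ (Module.End ℂ V) (energyShift n A : ℂ) =
      ∑ k, ((s k / 2 : ℝ) : ℂ) • (majoranaPlus c (u k) * majoranaMinus c (v k)) := by
  rw [hc.quadraticHamiltonian_sub_shift A B hA hB]
  simp only [hX, majoranaPlus, majoranaMinus, Finset.sum_mul_sum, Finset.smul_sum]
  push_cast
  simp only [Finset.sum_div, Finset.sum_smul]
  rw [Finset.sum_congr rfl fun i _ => Finset.sum_comm, Finset.sum_comm]
  refine Finset.sum_congr rfl fun k _ => Finset.sum_congr rfl fun i _ =>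
    Finset.sum_congr rfl fun j _ => ?_
  rw [smul_mul_smul_comm, smul_smul]
  congr 1
  ring

/-- Trace formula for the centred Hamiltonian: all signed half sums of the singular values of
`A + B` occur, each once. -/
theorem IsFermiFamily.trace_aeval_quadraticHamiltonian (hc : IsFermiFamily c)
    (hV : Module.finrank ℂ V = 2 ^ n)
    (A B : ℕ → ℕ → ℝ) (hA : ∀ i j, A i j = A j i) (hB : ∀ i j, B i j = -B j i)
    {s : Fin n → ℝ} {u v : OrthonormalBasis (Fin n) ℝ (EuclideanSpace ℝ (Fin n))}
    (hX : ∀ i j, truncatedSum n A B i j = ∑ k, s k * (u k i * v k j)) (p : Polynomial ℂ) :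
    LinearMap.trace ℂ V (Polynomial.aeval
        (quadraticHamiltonian c A B - algebraMap ℂ (Module.End ℂ V) (energyShift n A : ℂ)) p) =
      ∑ S : Finset (Fin n), p.eval
        (∑ k ∈ S, ((s k / 2 : ℝ) : ℂ) - ∑ k ∈ Finset.univ \ S, ((s k / 2 : ℝ) : ℂ)) := by
  have hu := sum_coord_mul_coord u
  have hv := sum_coord_mul_coord v
  rw [hc.quadraticHamiltonian_sub_shift_eq_sum A B hA hB (u := fun k => u k) (v := fun k => v k) hX]
  set a : Fin n → Module.End ℂ V := fun k => majoranaPlus c (u k)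
  set b : Fin n → Module.End ℂ V := fun k => majoranaMinus c (v k)
  have ha : ∀ k, a k * a k = 1 := fun k => by
    have := hc.majoranaPlus_anticomm (u k) (u k)
    rw [hu, if_pos rfl, ← two_smul ℂ, Algebra.algebraMap_eq_smul_one] at this
    simpa using this
  have hb : ∀ k, b k * b k = -1 := fun k => by
    have := hc.majoranaMinus_anticomm (v k) (v k)
    rw [hv, if_pos rfl, ← two_smul ℂ, Algebra.algebraMap_eq_smul_one, Complex.ofReal_one, mul_one,
      neg_smul, ← smul_neg] at this
    exact smul_right_injective _ (two_ne_zero' ℂ) this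
  have haa : ∀ k l, k ≠ l → a k * a l = -(a l * a k) := fun k l hkl => by
    have := hc.majoranaPlus_anticomm (u k) (u l)
    rw [hu, if_neg hkl] at this
    exact eq_neg_of_add_eq_zero_left (by simpa using this)
  have hbb : ∀ k l, k ≠ l → b k * b l = -(b l * b k) := fun k l hkl => by
    have := hc.majoranaMinus_anticomm (v k) (v l)
    rw [hv, if_neg hkl] at this
    exact eq_neg_of_add_eq_zero_left (by simpa using this)
  have hba : ∀ k l, b l * a k = -(a k * b l) := fun k l =>
    eq_neg_of_add_eq_zero_right (hc.majoranaPlus_majoranaMinus_anticomm (u k) (v l))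
  have hcomma : ∀ k l, k ≠ l → Commute (a k) (a l * b l) := fun k l hkl => by
    rw [commute_iff_eq, ← mul_assoc, haa k l hkl, mul_assoc (a l) (b l), hba]
    noncomm_ring
  have hcommb : ∀ k l, k ≠ l → Commute (b k) (a l * b l) := fun k l hkl => by
    rw [commute_iff_eq, ← mul_assoc, hba, mul_assoc (a l) (b l), neg_mul, mul_assoc (a l),
      hbb k l hkl, mul_neg, neg_neg]
  have key := trace_aeval_sum_smul (q := fun k => a k * b k) (a := a)
    (fun k => by
      rw [mul_assoc, ← mul_assoc (b k), hba, neg_mul, mul_assoc, hb, mul_neg, mul_neg, mul_neg,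
        mul_one, neg_neg, ha])
    ha
    (fun k => by rw [mul_assoc (a k) (b k), hba, mul_neg, neg_neg])
    hcomma (fun k l hkl => (hcomma k l hkl).mul_left (hcommb k l hkl))
    (fun k => ((s k / 2 : ℝ) : ℂ)) Finset.univ p
  rw [key]
  simp [LinearMap.trace_one, hV]

/-- The spectrum of the quadratic form: the energy levels, relative to the shift, are the signed
half sums of the singular values of `A + B`. -/
theorem IsFermiFamily.sum_energyLevel (hc : IsFermiFamily c)
    (hV : Module.finrank ℂ V = 2 ^ n)
    (A B : ℕ → ℕ → ℝ) (hA : ∀ i j, A i j = A j i) (hB : ∀ i j, B i j = -B j i)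
    {s : Fin n → ℝ} {u v : OrthonormalBasis (Fin n) ℝ (EuclideanSpace ℝ (Fin n))}
    (hX : ∀ i j, truncatedSum n A B i j = ∑ k, s k * (u k i * v k j)) (g : ℂ → ℂ) :
    ∑ k, g ((energyLevel hV c A B hA hB k : ℂ) - energyShift n A) =
      ∑ S : Finset (Fin n),
        g (∑ k ∈ S, ((s k / 2 : ℝ) : ℂ) - ∑ k ∈ Finset.univ \ S, ((s k / 2 : ℝ) : ℂ)) := by
  refine sum_eq_of_forall_polynomial
    (x := fun k => (energyLevel hV c A B hA hB k : ℂ) - energyShift n A)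
    (y := fun S : Finset (Fin n) =>
      ∑ k ∈ S, ((s k / 2 : ℝ) : ℂ) - ∑ k ∈ Finset.univ \ S, ((s k / 2 : ℝ) : ℂ))
    (fun p => ?_) g
  rw [← hc.trace_aeval_quadraticHamiltonian hV A B hA hB hX p]
  have h := (quadraticHamiltonian_isSymmetric c A B hA hB).trace_aeval_eq_sum hV
    (p.comp (Polynomial.X - Polynomial.C (energyShift n A : ℂ)))
  rw [Polynomial.aeval_comp, map_sub, Polynomial.aeval_X, Polynomial.aeval_C] at h
  rw [h]
  simp [energyLevel]

end Majorana

/-! ### Products of cosines and the Gaussian limit -/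

theorem abs_prod_sub_prod_le {ι : Type*} (T : Finset ι) {a b : ι → ℝ}
    (ha : ∀ k ∈ T, |a k| ≤ 1) (hb : ∀ k ∈ T, |b k| ≤ 1) :
    |∏ k ∈ T, a k - ∏ k ∈ T, b k| ≤ ∑ k ∈ T, |a k - b k| := by
  classical
  induction T using Finset.induction_on with
  | empty => simp
  | insert k T hk ih =>
    rw [Finset.prod_insert hk, Finset.prod_insert hk, Finset.sum_insert hk]
    have ih' := ih (fun l hl => ha l (Finset.mem_insert_of_mem hl))
      (fun l hl => hb l (Finset.mem_insert_of_mem hl))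
    have hbT : |∏ l ∈ T, b l| ≤ 1 := by
      rw [Finset.abs_prod]
      exact Finset.prod_le_one (fun _ _ => abs_nonneg _)
        fun l hl => hb l (Finset.mem_insert_of_mem hl)
    calc |a k * ∏ l ∈ T, a l - b k * ∏ l ∈ T, b l|
        = |(a k - b k) * ∏ l ∈ T, b l + a k * (∏ l ∈ T, a l - ∏ l ∈ T, b l)| := by
          congr 1; ring
      _ ≤ |a k - b k| * |∏ l ∈ T, b l| + |a k| * |∏ l ∈ T, a l - ∏ l ∈ T, b l| := by
          rw [← abs_mul, ← abs_mul]; exact abs_add_le _ _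
      _ ≤ |a k - b k| * 1 + 1 * ∑ l ∈ T, |a l - b l| := by
          gcongr
          exact ha k (Finset.mem_insert_self k T)
      _ = _ := by ring

theorem abs_cos_sub_exp_le {x : ℝ} (hx : |x| ≤ 1) :
    |Real.cos x - Real.exp (-(x ^ 2 / 2))| ≤ |x| ^ 4 := by
  have h1 := Real.cos_bound hx
  have hx2 : x ^ 2 ≤ 1 := by rw [← sq_abs]; exact pow_le_one₀ (abs_nonneg x) hx
  have h2 := Real.abs_exp_sub_one_sub_id_le (x := -(x ^ 2 / 2))
    (by rw [abs_neg, abs_of_nonneg (by positivity)]; linarith)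
  have h4 : |x| ^ 4 = x ^ 4 := by rw [← abs_pow, abs_of_nonneg (by positivity)]
  have h5 : (-(x ^ 2 / 2)) ^ 2 = x ^ 4 / 4 := by ring
  rw [h4] at h1 ⊢
  rw [h5] at h2
  have h6 : 0 ≤ x ^ 4 := by positivity
  rw [abs_le] at h1 h2 ⊢
  constructor <;> linarith [h1.1, h1.2, h2.1, h2.2]

/-- Lyapunov's central limit theorem for weighted sums of independent signs, in terms of
characteristic functions. -/
theorem tendsto_prod_cos {x : ∀ n : ℕ, Fin n → ℝ} {b : ℕ → ℝ} {τ : ℝ}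
    (hxb : ∀ n k, |x n k| ≤ b n) (hb : Tendsto (fun n : ℕ => n * b n ^ 4) atTop (𝓝 0))
    (hx : Tendsto (fun n => ∑ k, x n k ^ 2) atTop (𝓝 τ)) :
    Tendsto (fun n => ∏ k, Real.cos (x n k)) atTop (𝓝 (Real.exp (-(τ / 2)))) := by
  have hexp : Tendsto (fun n => ∏ k, Real.exp (-(x n k ^ 2 / 2))) atTop
      (𝓝 (Real.exp (-(τ / 2)))) := by
    simp only [← Real.exp_sum, Finset.sum_neg_distrib, ← Finset.sum_div]
    exact (Real.continuous_exp.tendsto _).comp ((hx.div_const 2).neg)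
  refine tendsto_of_tendsto_of_dist hexp (squeeze_zero' (.of_forall fun _ => dist_nonneg) ?_ hb)
  filter_upwards [hb.eventually (gt_mem_nhds one_pos), eventually_ge_atTop 1] with n hn hn1
  have hx1 : ∀ k, |x n k| ≤ 1 := fun k => by
    by_contra! h
    have h1 : 1 < b n := h.trans_le (hxb n k)
    have h2 : 1 ≤ b n ^ 4 := one_le_pow₀ h1.le
    have h3 : (1 : ℝ) ≤ n := by exact_mod_cast hn1
    nlinarith
  rw [dist_comm, Real.dist_eq]
  calc _ ≤ ∑ k, |Real.cos (x n k) - Real.exp (-(x n k ^ 2 / 2))| := by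
        refine abs_prod_sub_prod_le _ (fun k _ => Real.abs_cos_le_one _) fun k _ => ?_
        rw [Real.abs_exp]
        exact Real.exp_le_one_iff.mpr (by have := sq_nonneg (x n k); linarith)
    _ ≤ ∑ _k : Fin n, b n ^ 4 := Finset.sum_le_sum fun k _ =>
        (abs_cos_sub_exp_le (hx1 k)).trans (pow_le_pow_left₀ (abs_nonneg _) (hxb n k) 4)
    _ = n * b n ^ 4 := by simp

/-! ### Convergence for deterministic coefficients -/

section LevelDensity

variable {n : ℕ} {V : Type*} [NormedAddCommGroup V] [InnerProductSpace ℂ V]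
  [FiniteDimensional ℂ V] {c : Fin n → V →ₗ[ℂ] V}

theorem integral_rescaledLevelDensity {E : Type*} [NormedAddCommGroup E] [NormedSpace ℝ E]
    [CompleteSpace E] (hV : Module.finrank ℂ V = 2 ^ n) (A B : ℕ → ℕ → ℝ)
    (hA : ∀ i j, A i j = A j i) (hB : ∀ i j, B i j = -B j i) (g : ℝ → E) :
    ∫ x, g x ∂(rescaledLevelDensity hV c A B hA hB) =
      ((2 : ℝ) ^ n)⁻¹ • ∑ k, g ((energyLevel hV c A B hA hB k - energyShift n A) / Real.sqrt n) := by
  rw [rescaledLevelDensity, integral_smul_measure, integral_finsetSum_measure]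
  · simp
  · intro k _
    exact integrable_dirac (by simp)

instance isProbabilityMeasure_rescaledLevelDensity (hV : Module.finrank ℂ V = 2 ^ n)
    (A B : ℕ → ℕ → ℝ) (hA : ∀ i j, A i j = A j i) (hB : ∀ i j, B i j = -B j i) :
    IsProbabilityMeasure (rescaledLevelDensity hV c A B hA hB) := by
  constructor
  simp [rescaledLevelDensity]
  exact ENNReal.inv_mul_cancel (by simp) (by simp)

/-- The level density is the law of a sum of independent signs weighted by the rescaled
half singular values of `A + B`. -/
theorem IsFermiFamily.charFun_rescaledLevelDensity (hc : IsFermiFamily c)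
    (hV : Module.finrank ℂ V = 2 ^ n) (A B : ℕ → ℕ → ℝ)
    (hA : ∀ i j, A i j = A j i) (hB : ∀ i j, B i j = -B j i)
    {s : Fin n → ℝ} {u v : OrthonormalBasis (Fin n) ℝ (EuclideanSpace ℝ (Fin n))}
    (hX : ∀ i j, truncatedSum n A B i j = ∑ k, s k * (u k i * v k j)) (t : ℝ) :
    charFun (rescaledLevelDensity hV c A B hA hB) t =
      ((∏ k, Real.cos (t * s k / (2 * Real.sqrt n)) : ℝ) : ℂ) := by
  rw [charFun_apply_real, integral_rescaledLevelDensity]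
  have h := hc.sum_energyLevel hV A B hA hB hX
    (fun z => Complex.exp (t * (z / Real.sqrt n) * Complex.I))
  push_cast at h ⊢
  rw [h]
  have h2 : ∀ S : Finset (Fin n),
      Complex.exp (t * ((∑ k ∈ S, (s k : ℂ) / 2 - ∑ k ∈ Finset.univ \ S, (s k : ℂ) / 2) /
        Real.sqrt n) * Complex.I) =
      (∏ k ∈ S, Complex.exp (t * s k / (2 * Real.sqrt n) * Complex.I)) *
        ∏ k ∈ Finset.univ \ S, Complex.exp (-(t * s k / (2 * Real.sqrt n)) * Complex.I) := by
    intro S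
    rw [← Complex.exp_sum, ← Complex.exp_sum, ← Complex.exp_add, ← Finset.sum_mul,
      ← Finset.sum_mul, Finset.sum_neg_distrib, ← Finset.sum_div, ← Finset.sum_div,
      ← Finset.sum_div, ← Finset.sum_div, ← Finset.mul_sum, ← Finset.mul_sum]
    congr 1
    ring
  rw [Finset.sum_congr rfl fun S _ => h2 S, ← Finset.powerset_univ, ← Finset.prod_add,
    Finset.prod_congr rfl fun k _ => (Complex.two_cos _).symm, Finset.prod_mul_distrib]
  simp

end LevelDensity

/-- Deterministic coefficients: the level densities converge weakly. -/
theorem tendsto_integral_rescaledLevelDensity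
    (V : ℕ → Type*) [∀ n, NormedAddCommGroup (V n)] [∀ n, InnerProductSpace ℂ (V n)]
    [∀ n, FiniteDimensional ℂ (V n)] (hV : ∀ n, Module.finrank ℂ (V n) = 2 ^ n)
    (c : ∀ n, Fin n → V n →ₗ[ℂ] V n) (hc : ∀ n, IsFermiFamily (c n))
    (A B : ℕ → ℕ → ℕ → ℝ)
    (hA : ∀ n i j, A n i j = A n j i) (hB : ∀ n i j, B n i j = -B n j i) (σ : ℝ)
    (hnorm : Tendsto
      (fun n : ℕ => (n : ℝ) ^ (-(1 / 4) : ℝ) * matrixOpNorm (truncatedSum n (A n) (B n)))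
      atTop (𝓝 0))
    (htrace : Tendsto
      (fun n : ℕ => 1 / (4 * (n : ℝ)) *
        ((truncatedSum n (A n) (B n)).transpose * truncatedSum n (A n) (B n)).trace)
      atTop (𝓝 (σ ^ 2)))
    (f : ℝ →ᵇ ℝ) :
    Tendsto (fun n : ℕ =>
      ∫ x, f x ∂(rescaledLevelDensity (hV n) (c n) (A n) (B n) (hA n) (hB n)))
      atTop (𝓝 (∫ x, f x ∂(gaussianReal 0 (Real.toNNReal (σ ^ 2))))) := by
  choose s u v hX hs htr using fun n =>
    exists_matrix_singular_decomposition (truncatedSum n (A n) (B n))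
  let ν : ℕ → ProbabilityMeasure ℝ := fun n =>
    ⟨rescaledLevelDensity (hV n) (c n) (A n) (B n) (hA n) (hB n), inferInstance⟩
  let γ : ProbabilityMeasure ℝ := ⟨gaussianReal 0 (Real.toNNReal (σ ^ 2)), inferInstance⟩
  have hν : Tendsto ν atTop (𝓝 γ) := by
    rw [ProbabilityMeasure.tendsto_iff_tendsto_charFun]
    intro t
    change Tendsto (fun n => charFun (rescaledLevelDensity (hV n) (c n) (A n) (B n) (hA n) (hB n)) t)
      atTop (𝓝 (charFun (gaussianReal 0 (Real.toNNReal (σ ^ 2))) t))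
    have hγ : charFun (gaussianReal 0 (Real.toNNReal (σ ^ 2))) t =
        ((Real.exp (-(t ^ 2 * σ ^ 2 / 2)) : ℝ) : ℂ) := by
      rw [charFun_gaussianReal, Real.coe_toNNReal _ (sq_nonneg σ)]
      push_cast
      congr 1
      ring
    simp only [(hc _).charFun_rescaledLevelDensity (hV _) _ _ (hA _) (hB _) (hX _), hγ]
    refine (Complex.continuous_ofReal.tendsto _).comp ?_
    refine tendsto_prod_cos
      (b := fun n => |t| * matrixOpNorm (truncatedSum n (A n) (B n)) / (2 * Real.sqrt n)) ?_ ?_ ?_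
    · intro n k
      rw [abs_div, abs_mul, abs_of_nonneg (by positivity : 0 ≤ 2 * Real.sqrt n)]
      gcongr
      exact hs n k
    · have h := ((hnorm.pow 4).const_mul (t ^ 4 / 16))
      rw [zero_pow four_ne_zero, mul_zero] at h
      refine h.congr' ?_
      filter_upwards [eventually_ge_atTop 1] with n hn
      have hn0 : (0 : ℝ) < n := by exact_mod_cast hn
      have h1 : ((n : ℝ) ^ (-(1 / 4) : ℝ)) ^ 4 = (n : ℝ)⁻¹ := by
        rw [← Real.rpow_natCast, ← Real.rpow_mul hn0.le, ← Real.rpow_neg_one]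
        norm_num
      have h2 : Real.sqrt n ^ 4 = (n : ℝ) ^ 2 := by
        rw [show (4 : ℕ) = 2 * 2 from rfl, pow_mul, Real.sq_sqrt hn0.le]
      have h3 : |t| ^ 4 = t ^ 4 := by rw [← abs_pow, abs_of_nonneg (by positivity)]
      rw [mul_pow, h1, div_pow, mul_pow, mul_pow, h2, h3]
      field_simp
      ring
    · refine (htrace.const_mul (t ^ 2)).congr fun n => ?_
      rw [← htr n, Finset.mul_sum, Finset.mul_sum]
      refine Finset.sum_congr rfl fun k _ => ?_
      rw [div_pow, mul_pow, mul_pow, Real.sq_sqrt (Nat.cast_nonneg n)]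
      ring
  exact ProbabilityMeasure.tendsto_iff_forall_integral_tendsto.mp hν f

/-! ### Measurability of the averages over random levels -/

section Measurability

variable {Ω : Type*} [MeasurableSpace Ω]

/-- A sum of a continuous function over random points is measurable as soon as all power sums
are, although the single points, numbered in some way, need not be: polynomials approximate the
function uniformly on bounded sets. -/
theorem measurable_sum_of_forall_polynomial {ι : Type*} [Fintype ι] {x : Ω → ι → ℝ}
    (h : ∀ p : Polynomial ℝ, Measurable fun ω => ∑ k, p.eval (x ω k)) {f : ℝ → ℝ}
    (hf : Continuous f) : Measurable fun ω => ∑ k, f (x ω k) := by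
  have hp : ∀ m : ℕ, ∃ p : Polynomial ℝ, ∀ y ∈ Set.Icc (-(m : ℝ)) m,
      |p.eval y - f y| < 1 / ((m : ℝ) + 1) := fun m =>
    exists_polynomial_near_of_continuousOn _ _ f hf.continuousOn _ Nat.one_div_pos_of_nat
  choose p hp using hp
  refine measurable_of_tendsto_metrizable (fun m => h (p m)) (tendsto_pi_nhds.mpr fun ω => ?_)
  refine tendsto_finsetSum _ fun k _ => ?_
  rw [tendsto_iff_dist_tendsto_zero]
  refine squeeze_zero' (.of_forall fun _ => dist_nonneg) ?_ tendsto_one_div_add_atTop_nhds_zero_nat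
  filter_upwards [eventually_ge_atTop ⌈|x ω k|⌉₊] with m hm
  exact (hp m _ (abs_le.mp (Nat.ceil_le.mp hm))).le

/-- The trace of a polynomial in a random operator is measurable. -/
theorem measurable_trace_aeval {V ι : Type*} [AddCommGroup V] [Module ℂ V] [Fintype ι]
    [DecidableEq ι] (b : Module.Basis ι ℂ V) {M : Ω → Module.End ℂ V}
    (hM : ∀ i j, Measurable fun ω => LinearMap.toMatrixAlgEquiv b (M ω) i j)
    (p : Polynomial ℂ) :
    Measurable fun ω => LinearMap.trace ℂ V (Polynomial.aeval (M ω) p) := by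
  have hpow : ∀ m : ℕ, ∀ i j, Measurable fun ω => LinearMap.toMatrixAlgEquiv b (M ω ^ m) i j := by
    intro m
    induction m with
    | zero => simp
    | succ m ih =>
      intro i j
      simp only [pow_succ, map_mul, Matrix.mul_apply]
      exact Finset.measurable_sum _ fun k _ => (ih i k).mul (hM k j)
  simp only [Polynomial.aeval_eq_sum_range, map_sum, map_smul, smul_eq_mul]
  refine Finset.measurable_sum _ fun m _ => Measurable.const_mul ?_ _
  have : ∀ ω, LinearMap.trace ℂ V (M ω ^ m) = ∑ i, LinearMap.toMatrixAlgEquiv b (M ω ^ m) i i :=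
    fun ω => by rw [LinearMap.trace_eq_matrix_trace ℂ b]; rfl
  simp only [this]
  exact Finset.measurable_sum _ fun i _ => hpow m i i

theorem measurable_integral_rescaledLevelDensity {n : ℕ} {V : Type*} [NormedAddCommGroup V]
    [InnerProductSpace ℂ V] [FiniteDimensional ℂ V] {c : Fin n → V →ₗ[ℂ] V}
    (hV : Module.finrank ℂ V = 2 ^ n) {A B : Ω → ℕ → ℕ → ℝ}
    (hAmeas : ∀ i j, Measurable fun ω => A ω i j) (hBmeas : ∀ i j, Measurable fun ω => B ω i j)
    (hA : ∀ ω i j, A ω i j = A ω j i) (hB : ∀ ω i j, B ω i j = -B ω j i)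
    {f : ℝ → ℝ} (hf : Continuous f) :
    Measurable fun ω =>
      ∫ x, f x ∂(rescaledLevelDensity hV c (A ω) (B ω) (hA ω) (hB ω)) := by
  simp only [integral_rescaledLevelDensity, smul_eq_mul]
  refine Measurable.const_mul (measurable_sum_of_forall_polynomial (fun p => ?_) hf) _
  set b := (stdOrthonormalBasis ℂ V).toBasis
  -- the rescaled centred Hamiltonian, whose eigenvalues are the points of the level density
  have hM : ∀ i j, Measurable fun ω => LinearMap.toMatrixAlgEquiv b
      (((Real.sqrt n : ℂ)⁻¹) • (quadraticHamiltonian c (A ω) (B ω) -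
        algebraMap ℂ (Module.End ℂ V) (energyShift n (A ω) : ℂ))) i j := by
    intro i j
    have hK : Measurable fun ω => (energyShift n (A ω) : ℂ) :=
      Complex.measurable_ofReal.comp
        ((Finset.measurable_sum _ fun i _ => hAmeas _ _).div_const 2)
    simp only [quadraticHamiltonian, Algebra.algebraMap_eq_smul_one, map_smul, map_sub, map_sum,
      map_add, Matrix.smul_apply, Matrix.sub_apply, Matrix.sum_apply, Matrix.add_apply,
      smul_eq_mul]
    refine Measurable.const_mul (Measurable.sub ?_ (hK.mul_const _)) _
    refine Finset.measurable_sum _ fun k _ => Finset.measurable_sum _ fun l _ => ?_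
    exact ((Complex.measurable_ofReal.comp (hAmeas _ _)).mul_const _).add
      (((Complex.measurable_ofReal.comp (hBmeas _ _)).const_mul _).mul_const _)
  have h := Complex.measurable_re.comp
    (measurable_trace_aeval b hM (p.map (algebraMap ℝ ℂ)))
  refine (congrArg Measurable (funext fun ω => ?_)).mp h
  have h1 := (quadraticHamiltonian_isSymmetric c (A ω) (B ω) (hA ω) (hB ω)).trace_aeval_eq_sum hV
    ((p.map (algebraMap ℝ ℂ)).comp (Polynomial.C ((Real.sqrt n : ℂ)⁻¹) *
      (Polynomial.X - Polynomial.C (energyShift n (A ω) : ℂ))))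
  rw [Polynomial.aeval_comp, map_mul, map_sub, Polynomial.aeval_X, Polynomial.aeval_C,
    Polynomial.aeval_C, ← Algebra.smul_def] at h1
  rw [Function.comp_apply, h1, Complex.re_sum]
  refine Finset.sum_congr rfl fun k _ => ?_
  have h2 : (Real.sqrt n : ℂ)⁻¹ *
      ((energyLevel hV c (A ω) (B ω) (hA ω) (hB ω) k : ℂ) - energyShift n (A ω)) =
      algebraMap ℝ ℂ ((energyLevel hV c (A ω) (B ω) (hA ω) (hB ω) k - energyShift n (A ω)) /
        Real.sqrt n) := by
    simp only [Complex.coe_algebraMap]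
    push_cast
    ring
  simp only [Polynomial.eval_comp, Polynomial.eval_mul, Polynomial.eval_C, Polynomial.eval_sub,
    Polynomial.eval_X]
  change (Polynomial.eval ((Real.sqrt n : ℂ)⁻¹ *
      ((energyLevel hV c (A ω) (B ω) (hA ω) (hB ω) k : ℂ) - energyShift n (A ω))) _).re = _
  rw [h2, Polynomial.eval_map_algebraMap, Polynomial.aeval_algebraMap_apply]
  simp

end Measurability

/-! ### Random coefficients -/

/-- For random coefficient arrays (which may also depend on `n`) that satisfy almost surely
`n^{-1/4} ‖X_n‖_op → 0` and `Tr (X_nᵀ X_n) / (4 n) → σ²` with a deterministic `σ`, the rescaled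
level densities converge weakly in average to the centred Gaussian with variance `σ²`. -/
theorem corollary3
    {Ω : Type*} [MeasurableSpace Ω] (P : Measure Ω) [IsProbabilityMeasure P]
    (V : ℕ → Type*) [∀ n, NormedAddCommGroup (V n)] [∀ n, InnerProductSpace ℂ (V n)]
    [∀ n, FiniteDimensional ℂ (V n)] (hV : ∀ n, Module.finrank ℂ (V n) = 2 ^ n)
    (c : ∀ n, Fin n → V n →ₗ[ℂ] V n) (hc : ∀ n, IsFermiFamily (c n))
    (A B : ℕ → Ω → ℕ → ℕ → ℝ)
    (hAmeas : ∀ n i j, Measurable fun ω => A n ω i j)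
    (hBmeas : ∀ n i j, Measurable fun ω => B n ω i j)
    (hA : ∀ n ω i j, A n ω i j = A n ω j i)
    (hB : ∀ n ω i j, B n ω i j = -B n ω j i)
    (σ : ℝ)
    (hnorm : ∀ᵐ ω ∂P, Tendsto
      (fun n : ℕ => (n : ℝ) ^ (-(1 / 4) : ℝ) * matrixOpNorm (truncatedSum n (A n ω) (B n ω)))
      atTop (𝓝 0))
    (htrace : ∀ᵐ ω ∂P, Tendsto
      (fun n : ℕ => 1 / (4 * (n : ℝ)) *
        ((truncatedSum n (A n ω) (B n ω)).transpose * truncatedSum n (A n ω) (B n ω)).trace)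
      atTop (𝓝 (σ ^ 2)))
    (f : ℝ →ᵇ ℝ) :
    (∀ n, Integrable (fun ω =>
      ∫ x, f x ∂(rescaledLevelDensity (hV n) (c n) (A n ω) (B n ω) (hA n ω) (hB n ω))) P) ∧
    Tendsto (fun n : ℕ => ∫ ω,
      (∫ x, f x ∂(rescaledLevelDensity (hV n) (c n) (A n ω) (B n ω) (hA n ω) (hB n ω))) ∂P)
      atTop (𝓝 (∫ x, f x ∂(gaussianReal 0 (Real.toNNReal (σ ^ 2))))) := by
  have hbound : ∀ n ω,
      ‖∫ x, f x ∂(rescaledLevelDensity (hV n) (c n) (A n ω) (B n ω) (hA n ω) (hB n ω))‖ ≤ ‖f‖ :=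
    fun n ω => f.norm_integral_le_norm _
  have hmeas : ∀ n, AEStronglyMeasurable (fun ω =>
      ∫ x, f x ∂(rescaledLevelDensity (hV n) (c n) (A n ω) (B n ω) (hA n ω) (hB n ω))) P :=
    fun n => (measurable_integral_rescaledLevelDensity (hV n) (hAmeas n) (hBmeas n) (hA n) (hB n)
      f.continuous).aestronglyMeasurable
  refine ⟨fun n => .of_bound (hmeas n) ‖f‖ (.of_forall (hbound n)), ?_⟩
  have h := tendsto_integral_of_dominated_convergence (μ := P)
    (f := fun _ => ∫ x, f x ∂(gaussianReal 0 (Real.toNNReal (σ ^ 2)))) (fun _ => ‖f‖) hmeas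
    (integrable_const _) (fun n => .of_forall (hbound n)) ?_
  · simpa using h
  · filter_upwards [hnorm, htrace] with ω h1 h2
    exact tendsto_integral_rescaledLevelDensity V hV c hc (fun n => A n ω) (fun n => B n ω)
      (fun n => hA n ω) (fun n => hB n ω) σ h1 h2 f
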